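/- Let $S$ be a finite or countably infinite set and let $B=(B(x,y):x,y\in S)$ be a non-negative matrix that is sub-stochastic ($\sum_{y}B(x,y)\le 1$ for all $x$) and irreducible (for all $x,y\in S$ there is $n$ with $B^n(x,y)>0$). Let $\Delta\notin S$ and let $P$ be the stochastic matrix on $S\cup\{\Delta\}$ with $P(x,y)=B(x,y)$ and $P(x,\Delta)=1-\sum_{w\in S}B(x,w)$ for $x,y\in S$, $P(\Delta,\Delta)=1$, and $P(\Delta,y)=0$ for $y\in S$. Let $X=(X_n:n\ge 0)$ be a Markov chain on $S\cup\{\Delta\}$ with transition matrix $P$, and write $E_x$ for expectation given $X_0=x$. Put $T=\inf\{n\ge 0:X_n=\Delta\}$, fix $z\in S$, and put $\tau=\inf\{n\ge 1:X_n=z\}$ (with $\inf\emptyset=\infty$); the event $\{T>\tau\}$ is read so that $\tau<\infty$ on it. Assume: (A1) $\theta\ge 0$ is such that $E_z\,e^{\theta\tau}I(T>\tau)=1$; (A2) $E_z\,\tau e^{\theta\tau}I(T>\tau)<\infty$. Define $\lambda_*=e^{-\theta}$ and, for $x,y\in S$, $$u_*(x)=E_x\,e^{\theta\tau}I(T>\tau),\qquad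 \eta_*(y)=E_z\sum_{j=0}^{\tau-1}e^{\theta j}I(X_j=y,\,T>j).$$ Then: (i) If $u:S\to(0,\infty)$ satisfies $Bu=\lambda_*u$, i.e. $\sum_{y}B(x,y)u(y)=\lambda_*u(x)$ for all $x$, then $u=c\,u_*$ for some constant $0<c<\infty$. (ii) If $\eta:S\to(0,\infty)$ satisfies $\eta B=\lambda_*\eta$, i.e. $\sum_{x}\eta(x)B(x,y)=\lambda_*\eta(y)$ for all $y$, then $\eta=c\,\eta_*$ for some constant $0<c<\infty$. (iii) $\sum_{w\in S}\eta_*(w)u_*(w)<\infty$. (iv) If $p$ is the period of $B$, that is, $p=\gcd\{k\ge 1:B^k(w,w)>0\}$ (which is the same for every $w\in S$), then for all $x,y\in S$, as $n\to\infty$, $$\frac1p\sum_{j=0}^{p-1}\lambda_*^{-pn-j}B^{pn+j}(x,y)\;\longrightarrow\;\frac{u_*(x)\,\eta_*(y)}{\sum_{w\in S}u_*(w)\eta_*(w)}.$$ -/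

import Mathlib

open MeasureTheory Filter Topology
open scoped NNReal ENNReal

noncomputable section

namespace PerronFrobenius

/-- The `n`-th power `Bⁿ` of a (possibly infinite) non-negative matrix, with entries computed in
`[0, ∞]`. -/
def matPow {S : Type*} (B : S → S → ℝ≥0) : ℕ → S → S → ℝ≥0∞
  | 0 => fun x y => open Classical in if x = y then 1 else 0
  | n + 1 => fun x y => ∑' w, (B x w : ℝ≥0∞) * matPow B n w y

/-- `B` is sub-stochastic: all row sums are at most one. -/
def IsSubStochastic {S : Type*} (B : S → S → ℝ≥0) : Prop :=
  ∀ x, ∑' y, (B x y : ℝ≥0∞) ≤ 1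

/-- `B` is irreducible: for all `x, y` some power satisfies `Bⁿ(x, y) > 0`. -/
def IsIrreducible {S : Type*} (B : S → S → ℝ≥0) : Prop :=
  ∀ x y, ∃ n : ℕ, 0 < matPow B n x y

/-- The period of `B` at the state `w`: the greatest common divisor of `{k ≥ 1 : Bᵏ(w, w) > 0}`. -/
def period {S : Type*} (B : S → S → ℝ≥0) (w : S) : ℕ :=
  Nat.setGcd {k : ℕ | 1 ≤ k ∧ 0 < matPow B k w w}

/-- The transition matrix on `S_Δ = S ∪ {Δ}` obtained by sending the missing mass of each row of `B`
to the absorbing state `Δ`. Here `S_Δ` is `Option S` and `Δ` is `none`. -/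
def augmented {S : Type*} (B : S → S → ℝ≥0) : Option S → Option S → ℝ≥0∞
  | some x, some y => B x y
  | some x, none => 1 - ∑' y, (B x y : ℝ≥0∞)
  | none, none => 1
  | none, some _ => 0

/-- Under the family `ℙ x` of probability measures (`x` the initial state), the process `X` is a
Markov chain with values in the countable set `E` and with transition matrix `P`. -/
structure IsMarkovChain {E Ω : Type*} [MeasurableSpace Ω] (P : E → E → ℝ≥0∞)
    (X : ℕ → Ω → E) (ℙ : E → Measure Ω) : Prop where
  isProbabilityMeasure : ∀ x, IsProbabilityMeasure (ℙ x)
  measurableSet_eq : ∀ n y, MeasurableSet {ω | X n ω = y}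
  initial : ∀ x, ℙ x {ω | X 0 ω = x} = 1
  markov : ∀ (x : E) (n : ℕ) (a : ℕ → E),
    ℙ x {ω | ∀ i ≤ n + 1, X i ω = a i} = ℙ x {ω | ∀ i ≤ n, X i ω = a i} * P (a n) (a (n + 1))

section Times

variable {S Ω : Type*}

/-- `T = inf {n ≥ 0 : X_n = Δ}`, with `inf ∅ = ∞`. -/
def exitTime (X : ℕ → Ω → Option S) (ω : Ω) : ℕ∞ :=
  ⨅ (n : ℕ) (_ : X n ω = none), (n : ℕ∞)

/-- `τ = inf {n ≥ 1 : X_n = z}`, with `inf ∅ = ∞`. -/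
def returnTime (X : ℕ → Ω → Option S) (z : S) (ω : Ω) : ℕ∞ :=
  ⨅ (n : ℕ) (_ : 1 ≤ n ∧ X n ω = some z), (n : ℕ∞)

/-- The random variable `e^{θτ} I(T > τ)`; it vanishes when `τ = ∞`. -/
def expReturn (X : ℕ → Ω → Option S) (z : S) (θ : ℝ) (ω : Ω) : ℝ≥0∞ :=
  open Classical in
  if returnTime X z ω < exitTime X ω then
    ENNReal.ofReal (Real.exp (θ * ((returnTime X z ω).toNat : ℝ)))
  else 0

/-- The random variable `∑_{j=0}^{τ-1} e^{θj} I(X_j = y, T > j)`. -/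
def expOccupation (X : ℕ → Ω → Option S) (z : S) (θ : ℝ) (y : S) (ω : Ω) : ℝ≥0∞ :=
  ∑' j : ℕ, open Classical in
    if (j : ℕ∞) < returnTime X z ω ∧ X j ω = some y ∧ (j : ℕ∞) < exitTime X ω then
      ENNReal.ofReal (Real.exp (θ * (j : ℝ)))
    else 0

variable [MeasurableSpace Ω]

/-- Condition A1 for a given `θ`: `θ ≥ 0` and `E_z e^{θτ} I(T > τ) = 1`. -/
def A1 (X : ℕ → Ω → Option S) (ℙ : Option S → Measure Ω) (z : S) (θ : ℝ) : Prop :=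
  0 ≤ θ ∧ ∫⁻ ω, expReturn X z θ ω ∂(ℙ (some z)) = 1

/-- Condition A2: `E_z τ e^{θτ} I(T > τ) < ∞`. -/
def A2 (X : ℕ → Ω → Option S) (ℙ : Option S → Measure Ω) (z : S) (θ : ℝ) : Prop :=
  ∫⁻ ω, ((returnTime X z ω).toNat : ℝ≥0∞) * expReturn X z θ ω ∂(ℙ (some z)) < ∞

/-- `u_*(x) = E_x e^{θτ} I(T > τ)`. -/
def uStar (X : ℕ → Ω → Option S) (ℙ : Option S → Measure Ω) (z : S) (θ : ℝ) (x : S) : ℝ≥0∞ :=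
  ∫⁻ ω, expReturn X z θ ω ∂(ℙ (some x))

/-- `η_*(y) = E_z ∑_{j=0}^{τ-1} e^{θj} I(X_j = y, T > j)`. -/
def etaStar (X : ℕ → Ω → Option S) (ℙ : Option S → Measure Ω) (z : S) (θ : ℝ) (y : S) : ℝ≥0∞ :=
  ∫⁻ ω, expOccupation X z θ y ω ∂(ℙ (some z))

end Times

/-- `λ_* = e^{-θ}`. -/
def lamStar (θ : ℝ) : ℝ≥0∞ := ENNReal.ofReal (Real.exp (-θ))

end PerronFrobenius

end

/-! Rescale to `K = e^θ B`, which absorbs every factor `e^{θn}` into path weights. Then `u_*(x)` is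
the total weight of first passages from `x` to `z`, and `η_*(y)` that of paths from `z` to `y` with
no visit to `z` at a positive time. With `f k` the weight of first returns to `z` at time `k + 1`,
A1 says that the `f k` sum to 1 (recurrence), and A2 that the sum of `(k + 1) f k`, the mean return
time, is finite.

Decomposing at the first or last step gives `K u_* = u_*` and `η_* K = η_*`. Any non-negative fixed
vector `u` dominates `u(z) u_*`, because it dominates all partial sums over path lengths. The
difference is again non-negative and fixed, and vanishes at `z`; irreducibility spreads this zero
everywhere. Left vectors are dual (`eq_mul_passageWeight`, `eq_mul_occupationWeight`). For (iii),
cutting each first return to `z` at each of its times shows that the sum of `η_* u_*` is the mean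
return time.

For (iv), `K^n(z, z)` solves the renewal equation with increments `f`. Its sums over windows of
length `p` converge by a renewal theorem (`tendsto_of_renewal`): at an extremal cluster point, the
limits of the shifted sequence obey a maximum principle that makes them eventually constant, and a
conserved convolution with the tails of `f` fixes the constant. First passage decompositions,
written as power series identities, carry the limit from `(z, z)` to `(x, y)`. -/

namespace PerronFrobenius

/-! ### Path weights, first passages and the fixed vectors of a recurrent matrix. -/

section Matrix

variable {S : Type*}

theorem matPow_add (K : S → S → ℝ≥0) (m n : ℕ) (x y : S) :
    matPow K (m + n) x y = ∑' w, matPow K m x w * matPow K n w y := by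
  classical
  induction m generalizing x with
  | zero =>
    rw [tsum_eq_single x]
    · simp [matPow]
    · intro w hw
      simp [matPow, Ne.symm hw]
  | succ m ih =>
    rw [Nat.succ_add]
    simp only [matPow, ih, ← ENNReal.tsum_mul_left, ← ENNReal.tsum_mul_right]
    rw [ENNReal.tsum_comm]
    simp only [mul_assoc]

theorem matPow_one (K : S → S → ℝ≥0) (x y : S) : matPow K 1 x y = K x y := by
  classical
  simp only [matPow]
  rw [tsum_eq_single y]
  · simp
  · intro w hw
    simp [hw]

theorem matPow_succ_right (K : S → S → ℝ≥0) (n : ℕ) (x y : S) :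
    matPow K (n + 1) x y = ∑' w, matPow K n x w * K w y := by
  simp only [matPow_add, matPow_one]

theorem matPow_const_mul (c : ℝ≥0) (K : S → S → ℝ≥0) (n : ℕ) (x y : S) :
    matPow (fun x y => c * K x y) n x y = (c : ℝ≥0∞) ^ n * matPow K n x y := by
  induction n generalizing x with
  | zero => simp [matPow]
  | succ n ih =>
    simp only [matPow, ih, ← ENNReal.tsum_mul_left, ENNReal.coe_mul]
    refine tsum_congr fun w => ?_
    ring

/-- A single term of `K^n v = v`. Allowing the value `∞` in `v` lets this bound prove finiteness of
`u_*` as well as positivity and uniqueness. -/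
theorem matPow_mul_le_of_fixed {K : S → S → ℝ≥0} {v : S → ℝ≥0∞}
    (hv : ∀ x, ∑' y, (K x y : ℝ≥0∞) * v y = v x) (n : ℕ) (x y : S) :
    matPow K n x y * v y ≤ v x := by
  have h : ∀ x, ∑' y, matPow K n x y * v y = v x := by
    induction n with
    | zero =>
      intro x
      rw [tsum_eq_single x]
      · simp [matPow]
      · intro w hw
        simp [matPow, Ne.symm hw]
    | succ n ih =>
      intro x
      simp only [matPow, ← ENNReal.tsum_mul_right]
      rw [ENNReal.tsum_comm]
      simp only [mul_assoc, ENNReal.tsum_mul_left, ih, hv]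
  rw [← h x]
  exact ENNReal.le_tsum y

theorem mul_matPow_le_of_fixed {K : S → S → ℝ≥0} {v : S → ℝ≥0∞}
    (hv : ∀ y, ∑' x, v x * (K x y : ℝ≥0∞) = v y) (n : ℕ) (x y : S) :
    v x * matPow K n x y ≤ v y := by
  have h : ∀ y, ∑' x, v x * matPow K n x y = v y := by
    induction n with
    | zero =>
      intro y
      rw [tsum_eq_single y]
      · simp [matPow]
      · intro w hw
        simp [matPow, hw]
    | succ n ih =>
      intro y
      simp only [matPow_succ_right, ← ENNReal.tsum_mul_left]
      rw [ENNReal.tsum_comm]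
      simp only [← mul_assoc, ENNReal.tsum_mul_right, ih, hv]
  rw [← h y]
  exact ENNReal.le_tsum x

/-- The matrix `K` with the column of the state `z` replaced by zero. -/
noncomputable def taboo (K : S → S → ℝ≥0) (z : S) : S → S → ℝ≥0 :=
  open Classical in fun x y => if y = z then 0 else K x y

/-- The weight of all paths of length `n + 1` from `x` that visit `z` at their end and at no
positive time before. -/
noncomputable def firstPassage (K : S → S → ℝ≥0) (z : S) (n : ℕ) (x : S) : ℝ≥0∞ :=
  ∑' w, matPow (taboo K z) n x w * K w z

/-- The total weight of the first passages from `x` to `z`. -/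
noncomputable def passageWeight (K : S → S → ℝ≥0) (z x : S) : ℝ≥0∞ :=
  ∑' n, firstPassage K z n x

/-- The total weight of the paths from `z` to `y` that do not visit `z` at a positive time. -/
noncomputable def occupationWeight (K : S → S → ℝ≥0) (z y : S) : ℝ≥0∞ :=
  ∑' n, matPow (taboo K z) n z y

variable {K : S → S → ℝ≥0} {z : S}

theorem tsum_mul_eq_add_tsum_taboo (K : S → S → ℝ≥0) (z x : S) (v : S → ℝ≥0∞) :
    ∑' y, (K x y : ℝ≥0∞) * v y = K x z * v z + ∑' y, (taboo K z x y : ℝ≥0∞) * v y := by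
  classical
  have h : (K x z : ℝ≥0∞) * v z = ∑' y, if y = z then (K x y : ℝ≥0∞) * v y else 0 := by
    rw [tsum_eq_single z]
    · simp
    · intro y hy
      simp [hy]
  rw [h, ← ENNReal.tsum_add]
  refine tsum_congr fun y => ?_
  by_cases hy : y = z <;> simp [taboo, hy]

theorem taboo_self (K : S → S → ℝ≥0) (z x : S) : taboo K z x z = 0 := by simp [taboo]

theorem taboo_of_ne (K : S → S → ℝ≥0) {z y : S} (h : y ≠ z) (x : S) : taboo K z x y = K x y := by
  simp [taboo, h]

theorem matPow_taboo_succ_self (K : S → S → ℝ≥0) (z : S) (n : ℕ) (x : S) :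
    matPow (taboo K z) (n + 1) x z = 0 := by
  simp [matPow_succ_right, taboo_self]

theorem firstPassage_zero (K : S → S → ℝ≥0) (z x : S) : firstPassage K z 0 x = K x z := by
  unfold firstPassage
  rw [tsum_eq_single x]
  · simp [matPow]
  · intro w hw
    simp [matPow, Ne.symm hw]

theorem firstPassage_add (K : S → S → ℝ≥0) (z : S) (m n : ℕ) (x : S) :
    firstPassage K z (m + n) x = ∑' w, matPow (taboo K z) m x w * firstPassage K z n w := by
  simp only [firstPassage, matPow_add, ← ENNReal.tsum_mul_left, ← ENNReal.tsum_mul_right]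
  rw [ENNReal.tsum_comm]
  simp only [mul_assoc]

theorem firstPassage_succ (K : S → S → ℝ≥0) (z : S) (n : ℕ) (x : S) :
    firstPassage K z (n + 1) x = ∑' w, (taboo K z x w : ℝ≥0∞) * firstPassage K z n w := by
  rw [add_comm, firstPassage_add]
  simp only [matPow_one]

/-- First passage decomposition of the paths from `x` to `y`. -/
theorem matPow_eq_taboo_add_sum (K : S → S → ℝ≥0) (z : S) (n : ℕ) (x y : S) :
    matPow K n x y = matPow (taboo K z) n x y +
      ∑ k ∈ Finset.range n, firstPassage K z k x * matPow K (n - 1 - k) z y := by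
  induction n generalizing x with
  | zero => simp [matPow]
  | succ n ih =>
    calc matPow K (n + 1) x y = ∑' w, (K x w : ℝ≥0∞) * matPow K n w y := rfl
      _ = K x z * matPow K n z y + ∑' w, (taboo K z x w : ℝ≥0∞) * matPow K n w y :=
        tsum_mul_eq_add_tsum_taboo K z x _
      _ = K x z * matPow K n z y + ∑' w, ((taboo K z x w : ℝ≥0∞) * matPow (taboo K z) n w y +
            ∑ k ∈ Finset.range n, (taboo K z x w : ℝ≥0∞) *
              (firstPassage K z k w * matPow K (n - 1 - k) z y)) := by
        congr 1
        refine tsum_congr fun w => ?_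
        rw [ih w, mul_add, Finset.mul_sum]
      _ = K x z * matPow K n z y + (matPow (taboo K z) (n + 1) x y +
            ∑ k ∈ Finset.range n, firstPassage K z (k + 1) x * matPow K (n - 1 - k) z y) := by
        congr 1
        rw [ENNReal.tsum_add, Summable.tsum_finsetSum (fun _ _ => ENNReal.summable)]
        congr 1
        refine Finset.sum_congr rfl fun k _ => ?_
        rw [firstPassage_succ, ← ENNReal.tsum_mul_right]
        simp only [mul_assoc]
      _ = _ := by
        rw [Finset.sum_range_succ', firstPassage_zero]
        simp only [Nat.add_sub_cancel, Nat.sub_zero, Nat.sub_sub, add_comm 1]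
        ring

/-- The first step either hits `z` or continues a passage avoiding it. Recurrence enters only
through the value 1 at `z`. -/
theorem tsum_mul_passageWeight (h : passageWeight K z z = 1) (x : S) :
    ∑' y, (K x y : ℝ≥0∞) * passageWeight K z y = passageWeight K z x := by
  rw [tsum_mul_eq_add_tsum_taboo K z, h, mul_one]
  conv_rhs => rw [passageWeight, tsum_eq_zero_add' ENNReal.summable, firstPassage_zero]
  simp only [firstPassage_succ]
  rw [ENNReal.tsum_comm]
  simp only [ENNReal.tsum_mul_left]
  rfl

theorem tsum_occupationWeight_mul_self (K : S → S → ℝ≥0) (z : S) :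
    ∑' x, occupationWeight K z x * (K x z : ℝ≥0∞) = passageWeight K z z := by
  simp only [occupationWeight, passageWeight, firstPassage, ← ENNReal.tsum_mul_right]
  rw [ENNReal.tsum_comm]

theorem occupationWeight_self (K : S → S → ℝ≥0) (z : S) : occupationWeight K z z = 1 := by
  rw [occupationWeight, tsum_eq_zero_add' ENNReal.summable]
  simp only [matPow_taboo_succ_self]
  simp [matPow]

/-- Off `z`, appending a last step lengthens an avoiding path by one. At `z`, it closes a first
return, so recurrence gives the required value 1. -/
theorem tsum_occupationWeight_mul (h : passageWeight K z z = 1) (y : S) :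
    ∑' x, occupationWeight K z x * (K x y : ℝ≥0∞) = occupationWeight K z y := by
  by_cases hy : y = z
  · rw [hy, tsum_occupationWeight_mul_self, h, occupationWeight_self]
  · conv_rhs => rw [occupationWeight, tsum_eq_zero_add' ENNReal.summable]
    have h0 : matPow (taboo K z) 0 z y = 0 := by simp [matPow, Ne.symm hy]
    simp only [h0, zero_add, matPow_succ_right, taboo_of_ne K hy, occupationWeight,
      ← ENNReal.tsum_mul_right]
    rw [ENNReal.tsum_comm]

/-- Gluing an avoiding path of length `m` ending at `w` to a first passage from `w` and summing over
`w` gives the first returns to `z`, each cut at time `m`. -/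
theorem tsum_occupationWeight_mul_passageWeight (K : S → S → ℝ≥0) (z : S) :
    ∑' w, occupationWeight K z w * passageWeight K z w =
      ∑' m, ∑' n, firstPassage K z (m + n) z := by
  simp only [firstPassage_add, occupationWeight, passageWeight, ← ENNReal.tsum_mul_left,
    ← ENNReal.tsum_mul_right]
  rw [ENNReal.tsum_comm]
  simp only [ENNReal.tsum_comm (α := S)]
  rw [ENNReal.tsum_comm]

/-- There are `k + 1` pairs with sum `k`. Since `firstPassage` at index `k` has length `k + 1`, this
factor is exactly the return time. -/
theorem tsum_tsum_add_eq (a : ℕ → ℝ≥0∞) :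
    ∑' m, ∑' n, a (m + n) = ∑' k, ((k + 1 : ℕ) : ℝ≥0∞) * a k := by
  have h : ∀ m, ∑' n, a (m + n) = ∑' k, if m ≤ k then a k else 0 := by
    intro m
    have hs : (Function.support fun k => if m ≤ k then a k else 0) ⊆ Set.range (m + ·) := by
      intro k hk
      simp only [Function.mem_support, ne_eq, ite_eq_right_iff, Classical.not_imp] at hk
      exact ⟨k - m, by simp [hk.1]⟩
    rw [← (add_right_injective m).tsum_eq hs]
    simp
  simp only [h]
  rw [ENNReal.tsum_comm]
  refine tsum_congr fun k => ?_
  rw [tsum_eq_sum (s := Finset.range (k + 1))]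
  · rw [Finset.sum_congr rfl fun m hm => if_pos (Nat.lt_succ_iff.1 (Finset.mem_range.1 hm))]
    simp
  · intro m hm
    simp only [Finset.mem_range, not_lt] at hm
    rw [if_neg (by omega)]

theorem tsum_tsub {ι : Type*} {f g : ι → ℝ≥0∞} (hg : ∑' i, g i ≠ ∞) (h : ∀ i, g i ≤ f i) :
    ∑' i, (f i - g i) = ∑' i, f i - ∑' i, g i := by
  refine ENNReal.eq_sub_of_add_eq hg ?_
  rw [← ENNReal.tsum_add]
  exact tsum_congr fun i => tsub_add_cancel_of_le (h i)

/-! ### Minimality and uniqueness of the fixed vectors. -/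

theorem mul_passageWeight_le {u : S → ℝ≥0∞}
    (hu : ∀ x, ∑' y, (K x y : ℝ≥0∞) * u y = u x) (x : S) :
    u z * passageWeight K z x ≤ u x := by
  rw [passageWeight, ← ENNReal.tsum_mul_left]
  -- Truncate at passage time `N` and unfold `K u = u` once per induction step.
  refine ENNReal.tsum_le_of_sum_range_le fun N => ?_
  induction N generalizing x with
  | zero => simp
  | succ N ih =>
    rw [Finset.sum_range_succ', ← hu x, tsum_mul_eq_add_tsum_taboo K z, add_comm,
      firstPassage_zero, mul_comm (u z)]
    gcongr
    calc ∑ n ∈ Finset.range N, u z * firstPassage K z (n + 1) x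
        = ∑' w, (taboo K z x w : ℝ≥0∞) * ∑ n ∈ Finset.range N, u z * firstPassage K z n w := by
          simp only [firstPassage_succ, ← ENNReal.tsum_mul_left, Finset.mul_sum]
          rw [Summable.tsum_finsetSum (fun _ _ => ENNReal.summable)]
          refine Finset.sum_congr rfl fun n _ => tsum_congr fun w => ?_
          ring
      _ ≤ _ := by
          gcongr with w
          exact ih w

theorem mul_occupationWeight_le {v : S → ℝ≥0∞}
    (hv : ∀ y, ∑' x, v x * (K x y : ℝ≥0∞) = v y) (y : S) :
    v z * occupationWeight K z y ≤ v y := by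
  rw [occupationWeight, ← ENNReal.tsum_mul_left]
  refine ENNReal.tsum_le_of_sum_range_le fun N => ?_
  induction N generalizing y with
  | zero => simp
  | succ N ih =>
    rw [Finset.sum_range_succ']
    by_cases hy : y = z
    · simp only [hy, matPow_taboo_succ_self]
      simp [matPow]
    · have h0 : matPow (taboo K z) 0 z y = 0 := by simp [matPow, Ne.symm hy]
      rw [h0, mul_zero, add_zero, ← hv y]
      calc ∑ n ∈ Finset.range N, v z * matPow (taboo K z) (n + 1) z y
          = ∑' w, (∑ n ∈ Finset.range N, v z * matPow (taboo K z) n z w) * (K w y : ℝ≥0∞) := by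
            simp only [matPow_succ_right, taboo_of_ne K hy, ← ENNReal.tsum_mul_left,
              Finset.sum_mul]
            rw [Summable.tsum_finsetSum (fun _ _ => ENNReal.summable)]
            refine Finset.sum_congr rfl fun n _ => tsum_congr fun w => ?_
            ring
        _ ≤ _ := by
            gcongr with w
            exact ih w

theorem passageWeight_ne_top (hK : IsIrreducible K) (h : passageWeight K z z = 1) (x : S) :
    passageWeight K z x ≠ ∞ := by
  obtain ⟨n, hn⟩ := hK z x
  have := matPow_mul_le_of_fixed (tsum_mul_passageWeight h) n z x
  intro hx
  rw [hx, h, ENNReal.mul_top hn.ne'] at this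
  simp at this

theorem occupationWeight_ne_top (hK : IsIrreducible K) (h : passageWeight K z z = 1) (y : S) :
    occupationWeight K z y ≠ ∞ := by
  obtain ⟨n, hn⟩ := hK y z
  have := mul_matPow_le_of_fixed (tsum_occupationWeight_mul h) n y z
  intro hy
  rw [hy, occupationWeight_self, ENNReal.top_mul hn.ne'] at this
  simp at this

theorem passageWeight_pos (hK : IsIrreducible K) (h : passageWeight K z z = 1) (x : S) :
    0 < passageWeight K z x := by
  obtain ⟨n, hn⟩ := hK x z
  have := matPow_mul_le_of_fixed (tsum_mul_passageWeight h) n x z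
  rw [h, mul_one] at this
  exact hn.trans_le this

theorem eq_mul_passageWeight (hK : IsIrreducible K) (h : passageWeight K z z = 1)
    {u : S → ℝ≥0} (hu : ∀ x, ∑' y, (K x y : ℝ≥0∞) * u y = u x) (x : S) :
    (u x : ℝ≥0∞) = u z * passageWeight K z x := by
  have hle := mul_passageWeight_le (z := z) hu
  have hfix : ∀ x, ∑' y, (K x y : ℝ≥0∞) * (u y - u z * passageWeight K z y) =
      u x - u z * passageWeight K z x := by
    intro x
    have hs : ∑' y, (K x y : ℝ≥0∞) * (u z * passageWeight K z y) = u z * passageWeight K z x := by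
      simp only [mul_left_comm _ (u z : ℝ≥0∞), ENNReal.tsum_mul_left, tsum_mul_passageWeight h]
    calc ∑' y, (K x y : ℝ≥0∞) * (u y - u z * passageWeight K z y)
        = ∑' y, ((K x y : ℝ≥0∞) * u y - (K x y : ℝ≥0∞) * (u z * passageWeight K z y)) := by
          refine tsum_congr fun y => ENNReal.mul_sub fun _ _ => ENNReal.coe_ne_top
      _ = _ := by
          rw [tsum_tsub, hu, hs]
          · rw [hs]
            exact ENNReal.mul_ne_top ENNReal.coe_ne_top (passageWeight_ne_top hK h x)
          · intro y
            gcongr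
            exact hle y
  -- The fixed difference is zero at `z`, and a path of positive weight from `z` to `x` forces it to
  -- be zero at `x`.
  obtain ⟨n, hn⟩ := hK z x
  have := matPow_mul_le_of_fixed hfix n z x
  rw [h, mul_one, tsub_self, nonpos_iff_eq_zero, mul_eq_zero] at this
  exact le_antisymm (tsub_eq_zero_iff_le.1 (this.resolve_left hn.ne')) (hle x)

theorem eq_mul_occupationWeight (hK : IsIrreducible K) (h : passageWeight K z z = 1)
    {v : S → ℝ≥0} (hv : ∀ y, ∑' x, (v x : ℝ≥0∞) * K x y = v y) (y : S) :
    (v y : ℝ≥0∞) = v z * occupationWeight K z y := by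
  have hle := mul_occupationWeight_le (z := z) hv
  have hfix : ∀ y, ∑' x, (v x - v z * occupationWeight K z x) * (K x y : ℝ≥0∞) =
      v y - v z * occupationWeight K z y := by
    intro y
    have hs : ∑' x, (v z * occupationWeight K z x) * (K x y : ℝ≥0∞) =
        v z * occupationWeight K z y := by
      simp only [mul_assoc, ENNReal.tsum_mul_left, tsum_occupationWeight_mul h]
    calc ∑' x, (v x - v z * occupationWeight K z x) * (K x y : ℝ≥0∞)
        = ∑' x, (v x * (K x y : ℝ≥0∞) - (v z * occupationWeight K z x) * (K x y : ℝ≥0∞)) := by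
          refine tsum_congr fun x => ENNReal.sub_mul fun _ _ => ENNReal.coe_ne_top
      _ = _ := by
          rw [tsum_tsub, hv, hs]
          · rw [hs]
            exact ENNReal.mul_ne_top ENNReal.coe_ne_top (occupationWeight_ne_top hK h y)
          · intro x
            gcongr
            exact hle x
  obtain ⟨n, hn⟩ := hK y z
  have := mul_matPow_le_of_fixed hfix n y z
  rw [occupationWeight_self, mul_one, tsub_self, nonpos_iff_eq_zero, mul_eq_zero] at this
  exact le_antisymm (tsub_eq_zero_iff_le.1 (this.resolve_right hn.ne')) (hle y)

end Matrix

/-! ### A renewal theorem via cluster points. -/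

section Renewal

/-- Dominated convergence with bound `C * a k`. The filter is general because the lemma is applied
along an ultrafilter, where each shift has its own limit. -/
theorem tendsto_sum_range_mul {a x : ℕ → ℝ} {C : ℝ} (ha : Summable a) (ha0 : ∀ n, 0 ≤ a n)
    (hx : ∀ n, |x n| ≤ C) {l : Filter ℕ} (hl : l ≤ atTop) {L : ℕ → ℝ}
    (hL : ∀ k, Tendsto (fun n => x (n - k)) l (𝓝 (L k))) :
    Tendsto (fun n => ∑ k ∈ Finset.range (n + 1), a k * x (n - k)) l (𝓝 (∑' k, a k * L k)) := by
  have h : Tendsto (fun n => ∑' k, if k < n + 1 then a k * x (n - k) else 0) l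
      (𝓝 (∑' k, a k * L k)) := by
    refine tendsto_tsum_of_dominated_convergence (ha.mul_right C) (fun k => ?_)
      (Eventually.of_forall fun n k => ?_)
    · refine ((hL k).const_mul (a k)).congr' ?_
      filter_upwards [hl (eventually_ge_atTop k)] with n hn
      rw [if_pos (by omega)]
    · split_ifs
      · rw [Real.norm_eq_abs, abs_mul, abs_of_nonneg (ha0 k)]
        exact mul_le_mul_of_nonneg_left (hx _) (ha0 k)
      · rw [norm_zero]
        exact mul_nonneg (ha0 k) ((abs_nonneg _).trans (hx 0))
  refine h.congr fun n => ?_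
  rw [tsum_eq_sum (s := Finset.range (n + 1))]
  · exact Finset.sum_congr rfl fun k hk => if_pos (Finset.mem_range.1 hk)
  · intro k hk
    exact if_neg (by simpa using hk)

theorem tendsto_sum_range_mul_atTop {a x : ℕ → ℝ} {ℓ : ℝ} (ha : Summable a)
    (ha0 : ∀ n, 0 ≤ a n) (hℓ : Tendsto x atTop (𝓝 ℓ)) :
    Tendsto (fun n => ∑ k ∈ Finset.range (n + 1), a k * x (n - k)) atTop
      (𝓝 ((∑' k, a k) * ℓ)) := by
  rw [← tsum_mul_right]
  obtain ⟨C, hC⟩ := hℓ.abs.bddAbove_range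
  exact tendsto_sum_range_mul ha ha0 (fun n => hC ⟨n, rfl⟩) le_rfl fun k =>
    hℓ.comp (tendsto_sub_atTop_nat k)

/-- A maximal cluster point of an asymptotic solution of the renewal equation with a normalization
`ρ` is determined by that normalization. -/
theorem mul_tsum_eq_of_maximal_mapClusterPt {a ρ W : ℕ → ℝ} {p : ℕ} {C c v : ℝ}
    (ha : HasSum a 1) (ha0 : ∀ n, 0 ≤ a n) (hp : 0 < p)
    (hgcd : Nat.setGcd {k | 0 < a k} = p)
    (hρ : Summable ρ) (hρ0 : ∀ n, 0 ≤ ρ n) (hW : ∀ n, |W n| ≤ C)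
    (hWp : ∀ n, W n = W (p * (n / p)))
    (hren : Tendsto (fun n => W n - ∑ k ∈ Finset.range (n + 1), a k * W (n - k)) atTop (𝓝 0))
    (hnorm : Tendsto (fun n => ∑ k ∈ Finset.range (n + 1), ρ k * W (n - k)) atTop (𝓝 c))
    (hv : MapClusterPt v atTop W) (hmax : ∀ v', MapClusterPt v' atTop W → v' ≤ v) :
    (∑' k, ρ k) * v = c := by
  obtain ⟨U₀, hU₀, hvU₀⟩ := mapClusterPt_iff_ultrafilter.1 hv
  have hfloor : Tendsto (fun n => p * (n / p)) atTop atTop :=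
    (tendsto_id.const_mul_atTop' hp).comp (Nat.tendsto_div_const_atTop hp.ne')
  -- Rounding down to multiples of `p` does not change `W`, so the ultrafilter may be assumed to
  -- live on multiples of `p`.
  obtain ⟨U, hU, hvU, hdvd⟩ : ∃ U : Ultrafilter ℕ, ↑U ≤ (atTop : Filter ℕ) ∧
      Tendsto W U (𝓝 v) ∧ ∀ᶠ n in (U : Filter ℕ), p ∣ n := by
    refine ⟨U₀.map fun n => p * (n / p), ?_, ?_, ?_⟩
    · exact hfloor.mono_left hU₀
    · rw [Ultrafilter.coe_map, tendsto_map'_iff]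
      exact hvU₀.congr fun n => hWp n
    · rw [Ultrafilter.coe_map, eventually_map]
      exact Eventually.of_forall fun n => dvd_mul_right _ _
  have hsub : ∀ k, Tendsto (fun n => n - k) (U : Filter ℕ) atTop := fun k =>
    (tendsto_sub_atTop_nat k).mono_left hU
  have hex : ∀ k, ∃ w, Tendsto (fun n => W (n - k)) U (𝓝 w) := by
    intro k
    obtain ⟨w, -, hw⟩ := (isCompact_Icc (a := -C) (b := C)).ultrafilter_le_nhds
      (U.map fun n => W (n - k)) (by
        rw [le_principal_iff, Ultrafilter.coe_map, mem_map]
        exact univ_mem' fun n => abs_le.1 (hW (n - k)))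
    exact ⟨w, hw⟩
  choose L hL using hex
  have hLv : ∀ k, L k ≤ v := fun k => hmax _ <|
    MapClusterPt.of_comp (hsub k) (hL k).mapClusterPt
  have hL0 : L 0 = v := tendsto_nhds_unique (hL 0) hvU
  have hshift : ∀ j k, Tendsto (fun n => W (n - j - k)) U (𝓝 (L (j + k))) := fun j k =>
    (hL (j + k)).congr fun n => by rw [Nat.sub_sub]
  have hconv : ∀ {b : ℕ → ℝ}, Summable b → (∀ n, 0 ≤ b n) → ∀ j,
      Tendsto (fun n => ∑ k ∈ Finset.range (n - j + 1), b k * W (n - j - k)) U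
        (𝓝 (∑' k, b k * L (j + k))) := by
    intro b hb hb0 j
    have := tendsto_sum_range_mul (l := (U : Filter ℕ).map (fun n => n - j)) hb hb0 hW (hsub j)
      (L := fun k => L (j + k)) (fun k => tendsto_map'_iff.2 (hshift j k))
    exact tendsto_map'_iff.1 this
  -- The renewal equation passes to the limit: `L` is harmonic for the walk with increments `a`,
  -- bounded by `v`, with `L 0 = v`.
  have hharm : ∀ j, L j = ∑' k, a k * L (j + k) := by
    intro j
    have h1 := (hL j).sub (hconv ha.summable ha0 j)
    have h2 := tendsto_nhds_unique h1 (hren.comp (hsub j))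
    linarith
  have hbound : ∀ j, Summable fun k => a k * L (j + k) := by
    intro j
    refine Summable.of_norm_bounded (ha.summable.mul_right C) fun k => ?_
    rw [Real.norm_eq_abs, abs_mul, abs_of_nonneg (ha0 k)]
    refine mul_le_mul_of_nonneg_left ?_ (ha0 k)
    exact le_of_tendsto (hL (j + k)).abs (Eventually.of_forall fun n => hW _)
  -- Maximum principle: the non-negative numbers `v - L (j + k)` have `a`-average zero, hence vanish
  -- wherever `a k > 0`.
  have hstep : ∀ k, 0 < a k → ∀ j, L j = v → L (j + k) = v := by
    intro k hk j hj
    have hs : HasSum (fun k => a k * (v - L (j + k))) 0 := by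
      have := (ha.mul_right v).sub (hbound j).hasSum
      rw [← hharm j, hj, one_mul, sub_self] at this
      exact this.congr_fun (fun k => by ring)
    have h0 := (hasSum_zero_iff_of_nonneg fun k =>
      mul_nonneg (ha0 k) (sub_nonneg.2 (hLv (j + k)))).1 hs
    have := congrFun h0 k
    simp only [Pi.zero_apply, mul_eq_zero, hk.ne', false_or] at this
    linarith
  have hclosure : ∀ k ∈ AddSubmonoid.closure {k | 0 < a k}, ∀ j, L j = v → L (j + k) = v := by
    intro k hk
    induction hk using AddSubmonoid.closure_induction with
    | mem k hk => exact hstep k hk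
    | zero => simp
    | add k l _ _ ihk ihl =>
      intro j hj
      rw [← add_assoc]
      exact ihl _ (ihk j hj)
  obtain ⟨N, hN⟩ := Nat.exists_mem_closure_of_ge {k | 0 < a k}
  have hev : ∀ j, N ≤ j → L j = v := by
    intro j hj
    -- The semigroup generated by the support of `a` reaches only multiples of `p`. Here `q` is `j /
    -- p` rounded up; for `n` a multiple of `p`, `n - j` and `n - p * q` lie in the same block, on
    -- which `W` is constant.
    set q := (j + p - 1) / p with hq
    have hjq : j ≤ p * q := by
      have h1 := Nat.div_add_mod (j + p - 1) p
      have h2 := Nat.mod_lt (j + p - 1) hp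
      rw [← hq] at h1
      omega
    have hjq' : p * q ≤ j + p - 1 := Nat.mul_div_le _ _
    have h1 : L (p * q) = v := by
      have := hclosure (p * q) (hN _ (hj.trans hjq) (by rw [hgcd]; exact dvd_mul_right _ _)) 0 hL0
      rwa [zero_add] at this
    rw [← h1]
    refine tendsto_nhds_unique (hL j) ((hL (p * q)).congr' ?_)
    filter_upwards [hdvd, hU (eventually_ge_atTop (p * q))] with n hn hnq
    obtain ⟨m, rfl⟩ := hn
    have hqm : q ≤ m := Nat.le_of_mul_le_mul_left hnq hp
    rw [hWp (p * m - j)]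
    have : (p * m - j) / p = m - q := by
      obtain ⟨d, rfl⟩ := Nat.exists_eq_add_of_le hqm
      rw [mul_add, Nat.add_sub_cancel_left]
      have : p * q + p * d - j = (p * q - j) + p * d := by omega
      rw [this, Nat.add_mul_div_left _ _ hp, Nat.div_eq_of_lt (by omega), zero_add]
    rw [this, Nat.mul_sub]
  -- Beyond `N` every limit is `v`, so the normalization shifted by `N` reads `(∑ ρ) v = c`.
  have hlim := hconv hρ hρ0 N
  rw [tsum_congr fun k => by rw [hev (N + k) (Nat.le_add_right N k)], tsum_mul_right] at hlim
  exact tendsto_nhds_unique hlim (hnorm.comp (hsub N))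

/-- The renewal theorem of Erdős, Feller and Pollard, for arbitrary period `p`. -/
theorem tendsto_of_renewal {a ρ W : ℕ → ℝ} {p : ℕ} {C c : ℝ}
    (ha : HasSum a 1) (ha0 : ∀ n, 0 ≤ a n) (hp : 0 < p)
    (hgcd : Nat.setGcd {k | 0 < a k} = p)
    (hρ : Summable ρ) (hρ0 : ∀ n, 0 ≤ ρ n) (hρpos : 0 < ∑' k, ρ k) (hW : ∀ n, |W n| ≤ C)
    (hWp : ∀ n, W n = W (p * (n / p)))
    (hren : Tendsto (fun n => W n - ∑ k ∈ Finset.range (n + 1), a k * W (n - k)) atTop (𝓝 0))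
    (hnorm : Tendsto (fun n => ∑ k ∈ Finset.range (n + 1), ρ k * W (n - k)) atTop (𝓝 c)) :
    Tendsto W atTop (𝓝 (c / ∑' k, ρ k)) := by
  have hmem : ∀ᶠ n in atTop, W n ∈ Set.Icc (-C) C := Eventually.of_forall fun n => abs_le.1 (hW n)
  have hclosed : IsClosed {v | MapClusterPt v atTop W} := isClosed_setOfPred_clusterPt
  have hsubset : {v | MapClusterPt v atTop W} ⊆ Set.Icc (-C) C := fun v hv =>
    isClosed_Icc.mem_of_mapClusterPt hv hmem
  have hcompact : IsCompact {v | MapClusterPt v atTop W} :=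
    isCompact_Icc.of_isClosed_subset hclosed hsubset
  have hne : {v | MapClusterPt v atTop W}.Nonempty := by
    obtain ⟨v, -, hv⟩ := (isCompact_Icc (a := -C) (b := C)).exists_mapClusterPt
      (le_principal_iff.2 hmem)
    exact ⟨v, hv⟩
  obtain ⟨M, hM, hMmax⟩ := hcompact.exists_isGreatest hne
  obtain ⟨m, hm, hmmin⟩ := hcompact.exists_isLeast hne
  have h1 := mul_tsum_eq_of_maximal_mapClusterPt ha ha0 hp hgcd hρ hρ0 hW hWp hren hnorm hM
    fun v' hv' => hMmax hv'
  have hneg : ∀ {v} {x : ℕ → ℝ}, MapClusterPt v atTop x → MapClusterPt (-v) atTop (fun n => -x n) :=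
    fun h => h.tendsto_comp (continuous_neg.tendsto _)
  -- The least cluster point of `W` is handled as the greatest one of `-W`; both are then determined
  -- by `c`.
  have h2 := mul_tsum_eq_of_maximal_mapClusterPt (W := fun n => -W n) (C := C) (c := -c) ha ha0 hp
    hgcd hρ hρ0 (fun n => by rw [abs_neg]; exact hW n) (fun n => by rw [← hWp])
    (by
      have := hren.neg
      rw [neg_zero] at this
      refine this.congr fun n => ?_
      simp only [mul_neg, Finset.sum_neg_distrib]
      ring)
    (by
      refine hnorm.neg.congr fun n => ?_
      simp only [mul_neg, Finset.sum_neg_distrib])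
    (hneg hm)
    (fun v' hv' => by
      have := hmmin (show MapClusterPt (-v') atTop W by simpa using hneg hv')
      linarith)
  have hMm : M = m := by
    have : (∑' k, ρ k) * (M - m) = 0 := by linarith
    rcases mul_eq_zero.1 this with h | h
    · exact absurd h hρpos.ne'
    · linarith
  refine isCompact_Icc.tendsto_nhds_of_unique_mapClusterPt hmem fun v _ hv => ?_
  have hv1 : v ≤ M := hMmax hv
  have hv2 : m ≤ v := hmmin hv
  rw [eq_div_iff hρpos.ne', ← h1]
  have : v = M := le_antisymm hv1 (hMm ▸ hv2)
  rw [this, mul_comm]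

end Renewal

/-! ### Periods, generating functions and convergence of window sums. -/

section Convergence

variable {S : Type*} {K : S → S → ℝ≥0} {z : S}

theorem matPow_mul_matPow_le (K : S → S → ℝ≥0) (m n : ℕ) (x w y : S) :
    matPow K m x w * matPow K n w y ≤ matPow K (m + n) x y := by
  rw [matPow_add]
  exact ENNReal.le_tsum w

theorem period_dvd (K : S → S → ℝ≥0) {n : ℕ} {w : S} (h : 0 < matPow K n w w) :
    period K w ∣ n := by
  rcases Nat.eq_zero_or_pos n with rfl | hn
  · exact dvd_zero _
  · exact Nat.setGcd_dvd_of_mem ⟨hn, h⟩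

theorem period_dvd_period (hK : IsIrreducible K) (z w : S) : period K z ∣ period K w := by
  refine Nat.dvd_setGcd_iff.2 fun k hk => ?_
  obtain ⟨l, hl⟩ := hK z w
  obtain ⟨m, hm⟩ := hK w z
  have h1 : 0 < matPow K (l + m) z z :=
    (ENNReal.mul_pos hl.ne' hm.ne').trans_le (matPow_mul_matPow_le K l m z w z)
  have h2 : 0 < matPow K (l + k) z w :=
    (ENNReal.mul_pos hl.ne' hk.2.ne').trans_le (matPow_mul_matPow_le K l k z w w)
  have h3 : 0 < matPow K (l + k + m) z z :=
    (ENNReal.mul_pos h2.ne' hm.ne').trans_le (matPow_mul_matPow_le K (l + k) m z w z)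
  have h4 : l + k + m = (l + m) + k := by omega
  exact (Nat.dvd_add_right (period_dvd K h1)).1 (h4 ▸ period_dvd K h3)

theorem period_eq_period (hK : IsIrreducible K) (z w : S) : period K z = period K w :=
  Nat.dvd_antisymm (period_dvd_period hK z w) (period_dvd_period hK w z)

theorem firstPassage_le_matPow (K : S → S → ℝ≥0) (z : S) (n : ℕ) (x : S) :
    firstPassage K z n x ≤ matPow K (n + 1) x z := by
  rw [matPow_eq_taboo_add_sum K z]
  refine le_trans ?_ (le_add_left (Finset.single_le_sum (fun _ _ => zero_le)
    (Finset.self_mem_range_succ n)))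
  simp [matPow]

/-- Every return is a concatenation of first returns, so a common divisor of the first return times
divides all return times. -/
theorem setGcd_firstPassage (K : S → S → ℝ≥0) (z : S) :
    Nat.setGcd {k | 1 ≤ k ∧ 0 < firstPassage K z (k - 1) z} = period K z := by
  refine Nat.dvd_antisymm (Nat.dvd_setGcd_iff.2 fun n hn => ?_) (Nat.setGcd_mono fun k hk => ?_)
  · have h : ∀ n, 0 < matPow K n z z →
        Nat.setGcd {k | 1 ≤ k ∧ 0 < firstPassage K z (k - 1) z} ∣ n := by
      intro n
      induction n using Nat.strong_induction_on with
      | _ n ih =>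
        intro hn
        rcases n with _ | n
        · exact dvd_zero _
        rw [matPow_eq_taboo_add_sum K z, matPow_taboo_succ_self, zero_add] at hn
        obtain ⟨k, hk, hpos⟩ := Finset.exists_ne_zero_of_sum_ne_zero hn.ne'
        have hkn : k < n + 1 := Finset.mem_range.1 hk
        have hsplit : n + 1 = (k + 1) + (n + 1 - 1 - k) := by omega
        rw [hsplit]
        refine dvd_add (Nat.setGcd_dvd_of_mem ⟨Nat.succ_pos k, ?_⟩) (ih _ (by omega) ?_)
        · exact pos_iff_ne_zero.2 (left_ne_zero_of_mul hpos)
        · exact pos_iff_ne_zero.2 (right_ne_zero_of_mul hpos)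
    exact h n hn.2
  · refine ⟨hk.1, hk.2.trans_le ?_⟩
    have := firstPassage_le_matPow K z (k - 1) z
    rwa [Nat.sub_add_cancel hk.1] at this

theorem period_pos (h : passageWeight K z z = 1) : 0 < period K z := by
  rw [← setGcd_firstPassage, Nat.pos_iff_ne_zero, ne_eq, Nat.setGcd_eq_zero_iff]
  intro hsub
  have h0 : ∀ n, firstPassage K z n z = 0 := by
    intro n
    by_contra hn
    have : n + 1 ∈ ({0} : Set ℕ) := hsub ⟨Nat.succ_pos n, pos_iff_ne_zero.2 hn⟩
    simp at this
  simp [passageWeight, h0] at h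

theorem matPow_ne_top (hK : IsIrreducible K) (h : passageWeight K z z = 1) (n : ℕ) (x y : S) :
    matPow K n x y ≠ ∞ := by
  intro htop
  have := matPow_mul_le_of_fixed (tsum_mul_passageWeight h) n x y
  rw [htop, ENNReal.top_mul (passageWeight_pos hK h y).ne', top_le_iff] at this
  exact passageWeight_ne_top hK h x this

theorem matPow_taboo_le (K : S → S → ℝ≥0) (z : S) (n : ℕ) (x y : S) :
    matPow (taboo K z) n x y ≤ matPow K n x y := by
  rw [matPow_eq_taboo_add_sum K z]
  exact le_self_add

theorem matPow_taboo_ne_top (hK : IsIrreducible K) (h : passageWeight K z z = 1) (n : ℕ)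
    (x y : S) : matPow (taboo K z) n x y ≠ ∞ :=
  ne_top_of_le_ne_top (matPow_ne_top hK h n x y) (matPow_taboo_le K z n x y)

theorem hasSum_toReal_tsum {ι : Type*} {f : ι → ℝ≥0∞} (hf : ∑' i, f i ≠ ∞) :
    HasSum (fun i => (f i).toReal) (∑' i, f i).toReal := by
  rw [ENNReal.tsum_toReal_eq (ENNReal.ne_top_of_tsum_ne_top hf)]
  exact ENNReal.hasSum_toReal hf

theorem hasSum_firstPassage (hK : IsIrreducible K) (h : passageWeight K z z = 1) (x : S) :
    HasSum (fun n => (firstPassage K z n x).toReal) (passageWeight K z x).toReal :=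
  hasSum_toReal_tsum (passageWeight_ne_top hK h x)

theorem firstPassage_ne_top (hK : IsIrreducible K) (h : passageWeight K z z = 1) (n : ℕ) (x : S) :
    firstPassage K z n x ≠ ∞ :=
  ENNReal.ne_top_of_tsum_ne_top (passageWeight_ne_top hK h x) n

/-- Completing an avoiding path at `y` by a passage to `z` of fixed positive weight gives a first
passage from `x`, and those weights are summable. -/
theorem tendsto_matPow_taboo (hK : IsIrreducible K) (h : passageWeight K z z = 1) (x y : S) :
    Tendsto (fun n => (matPow (taboo K z) n x y).toReal) atTop (𝓝 0) := by
  obtain ⟨m, hm⟩ : ∃ m, firstPassage K z m y ≠ 0 := by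
    by_contra! hcon
    exact (passageWeight_pos hK h y).ne' (by simp [passageWeight, hcon])
  have hmpos : 0 < (firstPassage K z m y).toReal :=
    ENNReal.toReal_pos hm (firstPassage_ne_top hK h m y)
  have hlim := (((hasSum_firstPassage hK h x).summable.tendsto_atTop_zero).comp
    (tendsto_add_atTop_nat m)).div_const (firstPassage K z m y).toReal
  rw [zero_div] at hlim
  refine squeeze_zero (fun _ => ENNReal.toReal_nonneg) (fun n => ?_) hlim
  rw [le_div_iff₀ hmpos, ← ENNReal.toReal_mul]
  refine ENNReal.toReal_mono (firstPassage_ne_top hK h _ x) ?_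
  rw [firstPassage_add]
  exact ENNReal.le_tsum y

/-- The sequence of first passage weights, indexed by the passage time. -/
noncomputable def passageSeq (K : S → S → ℝ≥0) (z x : S) : ℕ → ℝ
  | 0 => 0
  | n + 1 => (firstPassage K z n x).toReal

theorem passageSeq_nonneg (K : S → S → ℝ≥0) (z x : S) : ∀ n, 0 ≤ passageSeq K z x n
  | 0 => le_rfl
  | _ + 1 => ENNReal.toReal_nonneg

theorem hasSum_passageSeq (hK : IsIrreducible K) (h : passageWeight K z z = 1) (x : S) :
    HasSum (passageSeq K z x) (passageWeight K z x).toReal := by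
  refine (hasSum_nat_add_iff' 1).1 ?_
  simpa [passageSeq] using hasSum_firstPassage hK h x

theorem setGcd_passageSeq (hK : IsIrreducible K) (h : passageWeight K z z = 1) :
    Nat.setGcd {k | 0 < passageSeq K z z k} = period K z := by
  rw [← setGcd_firstPassage]
  congr 1
  ext k
  rcases k with _ | k
  · simp [passageSeq]
  · simp [passageSeq, ENNReal.toReal_pos_iff, (firstPassage_ne_top hK h k z).lt_top]

-- Indexing by the passage time, with value 0 at time 0, turns the first passage decomposition into
-- a Cauchy product.
open PowerSeries in
theorem mk_matPow_eq (hK : IsIrreducible K) (h : passageWeight K z z = 1) (x y : S) :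
    (mk fun n => (matPow K n x y).toReal) = (mk fun n => (matPow (taboo K z) n x y).toReal) +
      mk (passageSeq K z x) * mk fun n => (matPow K n z y).toReal := by
  ext n
  rw [map_add, coeff_mul, Finset.Nat.sum_antidiagonal_eq_sum_range_succ_mk]
  simp only [coeff_mk]
  rw [matPow_eq_taboo_add_sum K z, ENNReal.toReal_add (matPow_taboo_ne_top hK h n x y),
    ENNReal.toReal_sum, Finset.sum_range_succ']
  · simp only [ENNReal.toReal_mul, passageSeq, zero_mul, add_zero, Nat.sub_sub, add_comm 1]
  · exact fun k _ => ENNReal.mul_ne_top (firstPassage_ne_top hK h k x) (matPow_ne_top hK h _ z y)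
  · exact ENNReal.sum_ne_top.2 fun k _ =>
      ENNReal.mul_ne_top (firstPassage_ne_top hK h k x) (matPow_ne_top hK h _ z y)

open PowerSeries in
theorem mk_matPow_self (hK : IsIrreducible K) (h : passageWeight K z z = 1) :
    (mk fun n => (matPow K n z z).toReal) =
      1 + mk (passageSeq K z z) * mk fun n => (matPow K n z z).toReal := by
  refine (mk_matPow_eq hK h z z).trans (congrArg (· + _) ?_)
  ext n
  rcases n with _ | n
  · simp [matPow]
  · rw [coeff_mk, matPow_taboo_succ_self]
    simp [coeff_one]

theorem coeff_mk_mul (a : ℕ → ℝ) (f : PowerSeries ℝ) (n : ℕ) :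
    PowerSeries.coeff n (PowerSeries.mk a * f) =
      ∑ k ∈ Finset.range (n + 1), a k * PowerSeries.coeff (n - k) f := by
  rw [PowerSeries.coeff_mul, Finset.Nat.sum_antidiagonal_eq_sum_range_succ_mk]
  simp

theorem tendsto_coeff_mk_mul {a : ℕ → ℝ} {f : PowerSeries ℝ} {s ℓ : ℝ} (ha : HasSum a s)
    (ha0 : ∀ n, 0 ≤ a n) (hf : Tendsto (fun n => PowerSeries.coeff n f) atTop (𝓝 ℓ)) :
    Tendsto (fun n => PowerSeries.coeff n (PowerSeries.mk a * f)) atTop (𝓝 (s * ℓ)) := by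
  rw [← ha.tsum_eq]
  refine (tendsto_sum_range_mul_atTop ha.summable ha0 hf).congr fun n => ?_
  rw [coeff_mk_mul]

/-- The indicator sequence of `{0, …, p - 1}`. -/
def window (p : ℕ) (n : ℕ) : ℝ := if n < p then 1 else 0

theorem window_nonneg (p n : ℕ) : 0 ≤ window p n := by
  unfold window
  split_ifs <;> norm_num

theorem hasSum_window (p : ℕ) : HasSum (window p) p := by
  have h : HasSum (window p) (∑ k ∈ Finset.range p, window p k) :=
    hasSum_sum_of_ne_finset_zero fun n hn => if_neg (by simpa using hn)
  have hone : ∑ k ∈ Finset.range p, window p k = ∑ k ∈ Finset.range p, 1 :=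
    Finset.sum_congr rfl fun k hk => if_pos (Finset.mem_range.1 hk)
  simpa [hone] using h

/-- The window looks backwards, so the block starting at `p * n` is read off at its last index `p *
n + (p - 1)`. -/
theorem coeff_window_mul (p : ℕ) (b : ℕ → ℝ) (n : ℕ) (hp : 0 < p) :
    PowerSeries.coeff (p * n + (p - 1)) (PowerSeries.mk (window p) * PowerSeries.mk b) =
      ∑ j ∈ Finset.range p, b (p * n + j) := by
  rw [coeff_mk_mul, ← Finset.sum_range_reflect (fun j => b (p * n + j))]
  have hsub : Finset.range p ⊆ Finset.range (p * n + (p - 1) + 1) :=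
    Finset.range_subset_range.2 (by omega)
  rw [← Finset.sum_subset hsub]
  · refine Finset.sum_congr rfl fun k hk => ?_
    have hk := Finset.mem_range.1 hk
    rw [window, if_pos hk, one_mul, PowerSeries.coeff_mk]
    congr 1
    omega
  · intro k _ hk
    rw [window, if_neg (by simpa using hk), zero_mul]

open PowerSeries in
/-- The window sums of the return weights converge. -/
theorem tendsto_window_mul_matPow (hK : IsIrreducible K) (h : passageWeight K z z = 1)
    (hfin : ∑' w, occupationWeight K z w * passageWeight K z w ≠ ∞) :
    Tendsto (fun n => coeff n (mk (window (period K z)) * mk fun n => (matPow K n z z).toReal))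
      atTop (𝓝 (period K z / (∑' w, occupationWeight K z w * passageWeight K z w).toReal)) := by
  set p := period K z with hpdef
  have hp : 0 < p := period_pos h
  set r : ℕ → ℝ := fun n => (matPow K n z z).toReal with hr
  set R : PowerSeries ℝ := mk r with hR
  set A : PowerSeries ℝ := mk (passageSeq K z z) with hA
  have hRA : R = 1 + A * R := mk_matPow_self hK h
  -- Tails of the return time: `ρ m` is the weight of `τ > m`, and the sum of `ρ` is the mean return
  -- time.
  set ρ : ℕ → ℝ := fun m => (∑' n, firstPassage K z (m + n) z).toReal with hρdef
  rw [tsum_occupationWeight_mul_passageWeight] at hfin ⊢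
  have hρsum : HasSum ρ (∑' m, ∑' n, firstPassage K z (m + n) z).toReal :=
    hasSum_toReal_tsum hfin
  have hρ0 : ∀ n, 0 ≤ ρ n := fun n => ENNReal.toReal_nonneg
  have hρfin : ∀ m, ∑' n, firstPassage K z (m + n) z ≠ ∞ := ENNReal.ne_top_of_tsum_ne_top hfin
  have hρzero : ρ 0 = 1 := by
    simp only [hρdef, zero_add]
    change (passageWeight K z z).toReal = 1
    simp [h]
  have hρsucc : ∀ m, ρ m = ρ (m + 1) + passageSeq K z z (m + 1) := by
    intro m
    simp only [hρdef, passageSeq]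
    rw [← ENNReal.toReal_add (hρfin _) (firstPassage_ne_top hK h m z),
      tsum_eq_zero_add' ENNReal.summable, add_comm]
    simp only [add_zero, add_assoc, add_comm 1]
  have hρA : mk ρ * (1 - X) = 1 - A := by
    ext n
    rw [mul_sub, mul_one, map_sub, map_sub]
    rcases n with _ | n
    · simp [hA, hρzero, passageSeq]
    · rw [coeff_succ_mul_X, coeff_mk, coeff_mk, hA, coeff_mk, hρsucc n]
      simp [coeff_one]
  have hone : (mk 1 : PowerSeries ℝ) * (1 - X) = 1 := mk_one_mul_one_sub_eq_one ℝ
  -- The conserved quantity: from `ρ (1 - X) = 1 - A` and `(1 - A) R = 1`, the convolution of `ρ`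
  -- with the return weights is constantly 1.
  have hρR : mk ρ * R = mk 1 := by
    have h1 : (1 - A) * R = 1 := by linear_combination hRA
    calc mk ρ * R = (mk ρ * (1 - X)) * R * mk 1 := by linear_combination (-(mk ρ * R)) * hone
      _ = mk 1 := by rw [hρA, h1, one_mul]
  have hrzero : ∀ n, ¬ p ∣ n → r n = 0 := by
    intro n hn
    by_contra hne
    refine hn (period_dvd K (pos_iff_ne_zero.2 fun h0 => hne ?_))
    simp [hr, h0]
  -- Return weights vanish off the multiples of `p`, and each window contains exactly one such
  -- multiple.
  have hW : ∀ n, coeff n (mk (window p) * R) = r (p * (n / p)) := by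
    intro n
    rw [hR, coeff_mk_mul, Finset.sum_eq_single (n % p)]
    · rw [window, if_pos (Nat.mod_lt n hp), one_mul, coeff_mk]
      congr 1
      have := Nat.div_add_mod n p
      omega
    · intro k hk hne
      rw [window]
      split_ifs with hkp
      · rw [coeff_mk, hrzero, mul_zero]
        rintro ⟨q, hq⟩
        apply hne
        have hk' := Finset.mem_range.1 hk
        have : n = k + p * q := by omega
        rw [this, Nat.add_mul_mod_self_left, Nat.mod_eq_of_lt hkp]
      · rw [zero_mul]
    · intro hn
      exact absurd (Finset.mem_range.2 (Nat.lt_succ_of_le (Nat.mod_le n p))) hn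
  have hwin0 : Tendsto (window p) atTop (𝓝 0) := (hasSum_window p).summable.tendsto_atTop_zero
  rw [← hρsum.tsum_eq]
  have ha : HasSum (passageSeq K z z) 1 := by simpa [h] using hasSum_passageSeq hK h z
  refine tendsto_of_renewal (C := 1) ha (passageSeq_nonneg K z z) hp (setGcd_passageSeq hK h)
    hρsum.summable hρ0 ?_ ?_ ?_ ?_ ?_
  · refine hρsum.summable.tsum_pos hρ0 0 ?_
    rw [hρzero]
    exact one_pos
  · intro n
    rw [hW, abs_of_nonneg ENNReal.toReal_nonneg]
    have := matPow_mul_le_of_fixed (tsum_mul_passageWeight h) (p * (n / p)) z z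
    rw [h, mul_one] at this
    simpa [hr] using ENNReal.toReal_mono ENNReal.one_ne_top this
  · intro n
    rw [hW, hW, Nat.mul_div_cancel_left _ hp]
  · refine hwin0.congr fun n => ?_
    rw [← coeff_mk_mul, ← map_sub]
    have : mk (window p) * R - mk (passageSeq K z z) * (mk (window p) * R) = mk (window p) := by
      linear_combination mk (window p) * hRA
    rw [this, coeff_mk]
  -- Convolving `ρ` with the window sums leaves partial sums of the window, which tend to `p`.
  · refine (hasSum_window p).tendsto_sum_nat.comp (tendsto_add_atTop_nat 1) |>.congr fun n => ?_
    rw [← coeff_mk_mul]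
    have : mk ρ * (mk (window p) * R) = mk (window p) * mk 1 := by
      rw [← hρR]
      ring
    rw [this, coeff_mk_mul]
    simp

open PowerSeries in
/-- The window sums of the powers of an irreducible positive recurrent matrix converge. -/
theorem tendsto_sum_matPow (hK : IsIrreducible K) (h : passageWeight K z z = 1)
    (hfin : ∑' w, occupationWeight K z w * passageWeight K z w ≠ ∞) (x y : S) :
    Tendsto (fun n => ∑ j ∈ Finset.range (period K z), (matPow K (period K z * n + j) x y).toReal)
      atTop (𝓝 ((passageWeight K z x).toReal * ((occupationWeight K z y).toReal *
        (period K z / (∑' w, occupationWeight K z w * passageWeight K z w).toReal)))) := by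
  set p := period K z with hpdef
  have hp : 0 < p := period_pos h
  -- Decomposition at the last visit to `z`, obtained by eliminating the first return series from
  -- the two renewal equations.
  have hz : (mk fun n => (matPow K n z y).toReal) =
      (mk fun n => (matPow (taboo K z) n z y).toReal) * mk fun n => (matPow K n z z).toReal := by
    linear_combination (mk fun n => (matPow K n z z).toReal) * mk_matPow_eq hK h z y -
      (mk fun n => (matPow K n z y).toReal) * mk_matPow_self hK h
  have hocc : HasSum (fun n => (matPow (taboo K z) n z y).toReal)
      (occupationWeight K z y).toReal := hasSum_toReal_tsum (occupationWeight_ne_top hK h y)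
  have h1 := tendsto_coeff_mk_mul hocc (fun _ => ENNReal.toReal_nonneg)
    (tendsto_window_mul_matPow hK h hfin)
  have h2 := tendsto_coeff_mk_mul (hasSum_passageSeq hK h x) (passageSeq_nonneg K z x) h1
  have h3 := tendsto_coeff_mk_mul (hasSum_window p) (window_nonneg p)
    (f := mk fun n => (matPow (taboo K z) n x y).toReal)
    (by simpa only [coeff_mk] using tendsto_matPow_taboo hK h x y)
  have h4 := h3.add h2
  rw [mul_zero, zero_add] at h4
  have hsub : Tendsto (fun n => p * n + (p - 1)) atTop atTop :=
    tendsto_atTop_mono (fun n => (Nat.le_mul_of_pos_left n hp).trans (Nat.le_add_right _ _)) tendsto_id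
  refine (h4.comp hsub).congr fun n => ?_
  rw [← coeff_window_mul p (fun n => (matPow K n x y).toReal) n hp, mk_matPow_eq hK h x y, hz,
    Function.comp_apply, ← map_add]
  congr 1
  ring

end Convergence

/-! ### Expectations of the chain as path weights. -/

section Probability

/-- The Markov property for events that depend on the path up to time `n`. -/
theorem IsMarkovChain.measure_path_inter {E Ω : Type*} [Countable E] [MeasurableSpace Ω]
    {P : E → E → ℝ≥0∞} {X : ℕ → Ω → E} {ℙ : E → Measure Ω} (hX : IsMarkovChain P X ℙ)
    (x : E) {n : ℕ} {C : Set (Fin (n + 1) → E)} {y : E} (hC : ∀ c ∈ C, c (Fin.last n) = y)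
    (y' : E) :
    ℙ x {ω | (fun i : Fin (n + 1) => X i ω) ∈ C ∧ X (n + 1) ω = y'} =
      ℙ x {ω | (fun i : Fin (n + 1) => X i ω) ∈ C} * P y y' := by
  have hpath : ∀ c : Fin (n + 1) → E,
      MeasurableSet {ω | (fun i : Fin (n + 1) => X i ω) = c} := by
    intro c
    have : {ω | (fun i : Fin (n + 1) => X i ω) = c} = ⋂ i : Fin (n + 1), {ω | X i ω = c i} := by
      ext ω
      simp [funext_iff]
    rw [this]
    exact MeasurableSet.iInter fun i => hX.measurableSet_eq i (c i)
  have h1 : {ω | (fun i : Fin (n + 1) => X i ω) ∈ C} =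
      ⋃ c : C, {ω | (fun i : Fin (n + 1) => X i ω) = c} := by
    ext ω
    simp
  have h2 : {ω | (fun i : Fin (n + 1) => X i ω) ∈ C ∧ X (n + 1) ω = y'} =
      ⋃ c : C, {ω | (fun i : Fin (n + 1) => X i ω) = c} ∩ {ω | X (n + 1) ω = y'} := by
    ext ω
    simp
  have hdisj : Pairwise (Function.onFun Disjoint
      fun c : C => {ω | (fun i : Fin (n + 1) => X i ω) = c}) := by
    intro c d hcd
    refine Set.disjoint_left.2 fun ω hc hd => hcd (Subtype.ext ?_)
    exact (show _ = _ from hc).symm.trans hd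
  rw [h1, h2, measure_iUnion hdisj fun c => hpath c,
    measure_iUnion (fun c d hcd => (hdisj hcd).mono Set.inter_subset_left Set.inter_subset_left)
      fun c => (hpath c).inter (hX.measurableSet_eq (n + 1) y'), ← ENNReal.tsum_mul_right]
  refine tsum_congr fun ⟨c, hc⟩ => ?_
  -- The Markov hypothesis concerns single paths, so the finite path `c` is extended by `y'`; values
  -- past `n + 1` play no role.
  set a : ℕ → E := fun i => if h : i < n + 1 then c ⟨i, h⟩ else y' with ha
  have han : a n = y := by
    simp only [ha, Nat.lt_succ_self, dif_pos]
    exact hC c hc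
  have hasucc : a (n + 1) = y' := by simp [ha]
  have h3 : {ω | (fun i : Fin (n + 1) => X i ω) = c} = {ω | ∀ i ≤ n, X i ω = a i} := by
    ext ω
    simp only [Set.mem_ofPred_eq, funext_iff, Fin.forall_iff, ← Nat.lt_succ_iff]
    refine forall_congr' fun i => forall_congr' fun hi => ?_
    simp only [ha, dif_pos hi]
  have h4 : {ω | (fun i : Fin (n + 1) => X i ω) = c} ∩ {ω | X (n + 1) ω = y'} =
      {ω | ∀ i ≤ n + 1, X i ω = a i} := by
    rw [h3]
    ext ω
    simp only [Set.mem_inter_iff, Set.mem_ofPred_eq, Nat.le_succ_iff, or_imp, forall_and,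
      forall_eq, Nat.succ_eq_add_one, hasucc]
  change ℙ x ({ω | (fun i : Fin (n + 1) => X i ω) = c} ∩ _) =
    ℙ x {ω | (fun i : Fin (n + 1) => X i ω) = c} * _
  rw [h4, h3, hX.markov, han, hasucc]

variable {S Ω : Type*}

theorem lt_exitTime_iff (X : ℕ → Ω → Option S) (n : ℕ) (ω : Ω) :
    (n : ℕ∞) < exitTime X ω ↔ ∀ i ≤ n, X i ω ≠ none := by
  rw [← ENat.add_one_le_iff (ENat.natCast_ne_top n), exitTime]
  simp only [le_iInf_iff]
  refine forall_congr' fun i => ?_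
  norm_cast
  rw [Nat.succ_le_iff, ← not_le, ← not_imp_not, not_not]

theorem lt_returnTime_iff (X : ℕ → Ω → Option S) (z : S) (n : ℕ) (ω : Ω) :
    (n : ℕ∞) < returnTime X z ω ↔ ∀ i ≤ n, 1 ≤ i → X i ω ≠ some z := by
  rw [← ENat.add_one_le_iff (ENat.natCast_ne_top n), returnTime]
  simp only [le_iInf_iff]
  refine forall_congr' fun i => ?_
  norm_cast
  rw [Nat.succ_le_iff, ← not_le]
  exact ⟨fun h hi hi1 hz => absurd (h ⟨hi1, hz⟩) (by omega),
    fun h hz => by_contra fun hi => h (by omega) hz.1 hz.2⟩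

/-- The event that the chain is in `y` at time `n`, has not been absorbed, and has not visited `z`
at a positive time up to `n`. -/
def tabooEvent (X : ℕ → Ω → Option S) (z : S) (n : ℕ) (y : S) : Set Ω :=
  {ω | X n ω = some y ∧ (∀ i ≤ n, X i ω ≠ none) ∧ ∀ i ≤ n, 1 ≤ i → X i ω ≠ some z}

/-- The event that the first visit to `z` at a positive time happens at time `n + 1`, before
absorption. -/
def returnEvent (X : ℕ → Ω → Option S) (z : S) (n : ℕ) : Set Ω :=
  ⋃ w, tabooEvent X z n w ∩ {ω | X (n + 1) ω = some z}

theorem mem_returnEvent_iff (X : ℕ → Ω → Option S) (z : S) (n : ℕ) (ω : Ω) :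
    ω ∈ returnEvent X z n ↔
      returnTime X z ω = (n + 1 : ℕ) ∧ returnTime X z ω < exitTime X ω := by
  have h1 : returnTime X z ω = (n + 1 : ℕ) ↔
      (n : ℕ∞) < returnTime X z ω ∧ ¬ ((n + 1 : ℕ) : ℕ∞) < returnTime X z ω := by
    rw [← ENat.add_one_le_iff (ENat.natCast_ne_top n), not_lt, le_antisymm_iff, and_comm]
    push_cast
    rfl
  have h2 : (returnTime X z ω = (n + 1 : ℕ) ∧ returnTime X z ω < exitTime X ω) ↔
      returnTime X z ω = (n + 1 : ℕ) ∧ ((n + 1 : ℕ) : ℕ∞) < exitTime X ω :=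
    and_congr_right fun h => by rw [h]
  rw [h2, h1, lt_returnTime_iff, lt_returnTime_iff, lt_exitTime_iff]
  simp only [returnEvent, tabooEvent, Set.mem_iUnion, Set.mem_inter_iff, Set.mem_ofPred_eq]
  constructor
  · rintro ⟨w, ⟨hw, hnone, hz⟩, hlast⟩
    refine ⟨⟨hz, fun hcon => hcon (n + 1) le_rfl (Nat.succ_pos n) hlast⟩, fun i hi => ?_⟩
    rcases Nat.le_succ_iff.1 hi with hi | rfl
    · exact hnone i hi
    · simp [hlast]
  · rintro ⟨⟨hz, hex⟩, hnone⟩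
    obtain ⟨w, hw⟩ := Option.ne_none_iff_exists'.1 (hnone n (Nat.le_succ n))
    refine ⟨w, ⟨hw, fun i hi => hnone i (hi.trans (Nat.le_succ n)), hz⟩, ?_⟩
    push Not at hex
    obtain ⟨i, hi, hi1, hiz⟩ := hex
    rcases Nat.le_succ_iff.1 hi with hi | rfl
    · exact absurd hiz (hz i hi hi1)
    · exact hiz

/-- A general `g` serves both `e^{θτ}` and `τ e^{θτ}`. -/
theorem ite_returnTime_eq_tsum (X : ℕ → Ω → Option S) (z : S) (g : ℕ → ℝ≥0∞) (ω : Ω) :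
    (open Classical in
      if returnTime X z ω < exitTime X ω then g (returnTime X z ω).toNat else 0) =
      ∑' n, (returnEvent X z n).indicator (fun _ => g (n + 1)) ω := by
  classical
  split_ifs with h
  · obtain ⟨m, hm⟩ := ENat.ne_top_iff_exists.1 (ne_top_of_lt h)
    obtain ⟨n, rfl⟩ : ∃ n, m = n + 1 := by
      refine Nat.exists_eq_succ_of_ne_zero fun h0 => ?_
      have := (lt_returnTime_iff X z 0 ω).2 fun i hi hi1 => by omega
      rw [← hm, h0] at this
      exact lt_irrefl _ this
    rw [tsum_eq_single n]
    · rw [Set.indicator_of_mem ((mem_returnEvent_iff X z n ω).2 ⟨hm.symm, h⟩), ← hm]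
      rfl
    · intro k hk
      refine Set.indicator_of_notMem (fun hmem => hk ?_) _
      have := ((mem_returnEvent_iff X z k ω).1 hmem).1
      rw [← hm, Nat.cast_inj] at this
      omega
  · refine (ENNReal.tsum_eq_zero.2 fun n => Set.indicator_of_notMem (fun hmem => h ?_) _).symm
    exact ((mem_returnEvent_iff X z n ω).1 hmem).2

theorem pairwise_disjoint_tabooEvent_inter (X : ℕ → Ω → Option S) (z : S) (n : ℕ) (A : Set Ω) :
    Pairwise (Function.onFun Disjoint fun w => tabooEvent X z n w ∩ A) := by
  intro v w hvw
  refine Set.disjoint_left.2 fun ω hv hw => hvw ?_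
  exact Option.some_injective _ (hv.1.1.symm.trans hw.1.1)

theorem taboo_const_mul (c : ℝ≥0) (B : S → S → ℝ≥0) (z : S) :
    taboo (fun x y => c * B x y) z = fun x y => c * taboo B z x y := by
  ext x y
  by_cases hy : y = z <;> simp [taboo, hy]

theorem firstPassage_const_mul (c : ℝ≥0) (B : S → S → ℝ≥0) (z : S) (n : ℕ) (x : S) :
    firstPassage (fun x y => c * B x y) z n x = (c : ℝ≥0∞) ^ (n + 1) * firstPassage B z n x := by
  simp only [firstPassage, taboo_const_mul, matPow_const_mul, ← ENNReal.tsum_mul_left,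
    ENNReal.coe_mul]
  refine tsum_congr fun w => ?_
  ring

theorem ofReal_exp_mul_natCast (θ : ℝ) (n : ℕ) :
    ENNReal.ofReal (Real.exp (θ * n)) = ((Real.exp θ).toNNReal : ℝ≥0∞) ^ n := by
  rw [mul_comm, Real.exp_nat_mul, ENNReal.ofReal_pow (Real.exp_pos θ).le]
  rfl

section Markov

variable [MeasurableSpace Ω] {B : S → S → ℝ≥0} {X : ℕ → Ω → Option S}
  {ℙ : Option S → Measure Ω}

theorem IsMarkovChain.measurableSet_tabooEvent (hX : IsMarkovChain (augmented B) X ℙ) (z : S)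
    (n : ℕ) (y : S) : MeasurableSet (tabooEvent X z n y) := by
  have : tabooEvent X z n y = {ω | X n ω = some y} ∩ ((⋂ i, ⋂ (_ : i ≤ n), {ω | X i ω = none}ᶜ) ∩
      ⋂ i, ⋂ (_ : i ≤ n), ⋂ (_ : 1 ≤ i), {ω | X i ω = some z}ᶜ) := by
    ext ω
    simp [tabooEvent]
  rw [this]
  refine (hX.measurableSet_eq n _).inter (MeasurableSet.inter ?_ ?_)
  · exact MeasurableSet.iInter fun i => MeasurableSet.iInter fun _ => (hX.measurableSet_eq i _).compl
  · exact MeasurableSet.iInter fun i => MeasurableSet.iInter fun _ => MeasurableSet.iInter fun _ =>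
      (hX.measurableSet_eq i _).compl

variable [Countable S]

theorem IsMarkovChain.measurableSet_returnEvent (hX : IsMarkovChain (augmented B) X ℙ) (z : S)
    (n : ℕ) : MeasurableSet (returnEvent X z n) :=
  MeasurableSet.iUnion fun w => (hX.measurableSet_tabooEvent z n w).inter (hX.measurableSet_eq _ _)

theorem IsMarkovChain.measure_tabooEvent_inter (hX : IsMarkovChain (augmented B) X ℙ) (z : S)
    (x : Option S) (n : ℕ) (w y : S) :
    ℙ x (tabooEvent X z n w ∩ {ω | X (n + 1) ω = some y}) =
      ℙ x (tabooEvent X z n w) * B w y := by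
  have := hX.measure_path_inter x (n := n) (y := some w)
    (C := {c | c (Fin.last n) = some w ∧ (∀ i, c i ≠ none) ∧
      ∀ i : Fin (n + 1), 1 ≤ (i : ℕ) → c i ≠ some z}) (fun c hc => hc.1) (some y)
  have h : {ω | (fun i : Fin (n + 1) => X i ω) ∈ {c : Fin (n + 1) → Option S |
      c (Fin.last n) = some w ∧ (∀ i, c i ≠ none) ∧
      ∀ i : Fin (n + 1), 1 ≤ (i : ℕ) → c i ≠ some z}} = tabooEvent X z n w := by
    ext ω
    simp only [Set.mem_ofPred_eq, tabooEvent, Fin.forall_iff, ← Nat.lt_succ_iff, Fin.val_last]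
  rw [← h]
  exact this

/-- Induction on time, splitting by the state before the last step; the zero column of `taboo B z`
reflects that the event is empty at `z` for positive times. -/
theorem IsMarkovChain.measure_tabooEvent (hX : IsMarkovChain (augmented B) X ℙ) (z : S)
    (n : ℕ) (x y : S) : ℙ (some x) (tabooEvent X z n y) = matPow (taboo B z) n x y := by
  have := hX.isProbabilityMeasure (some x)
  induction n generalizing y with
  | zero =>
    have h : tabooEvent X z 0 y = {ω | X 0 ω = some y} := by
      ext ω
      simp only [tabooEvent, Set.mem_ofPred_eq, and_iff_left_iff_imp]
      intro h0
      refine ⟨fun i hi => ?_, fun i hi hi1 => by omega⟩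
      rw [Nat.le_zero.1 hi, h0]
      simp
    rw [h]
    by_cases hxy : x = y
    · simp [matPow, hxy, hX.initial]
    · simp only [matPow, hxy, if_false]
      refine measure_mono_null (fun ω hω => ?_)
        ((prob_compl_eq_zero_iff (hX.measurableSet_eq 0 (some x))).2 (hX.initial (some x)))
      intro hx
      exact hxy (Option.some_injective _ ((show X 0 ω = some x from hx).symm.trans hω))
  | succ n ih =>
    rw [matPow_succ_right]
    by_cases hy : y = z
    · have h : tabooEvent X z (n + 1) y = ∅ := by
        refine Set.eq_empty_of_forall_notMem fun ω hω => ?_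
        exact hω.2.2 (n + 1) le_rfl (Nat.succ_pos n) (hy ▸ hω.1)
      rw [h, measure_empty, hy]
      simp [taboo_self]
    · have h : tabooEvent X z (n + 1) y =
          ⋃ w, tabooEvent X z n w ∩ {ω | X (n + 1) ω = some y} := by
        ext ω
        simp only [tabooEvent, Set.mem_iUnion, Set.mem_inter_iff, Set.mem_ofPred_eq]
        constructor
        · rintro ⟨h1, h2, h3⟩
          obtain ⟨w, hw⟩ := Option.ne_none_iff_exists'.1 (h2 n (Nat.le_succ n))
          exact ⟨w, ⟨hw, fun i hi => h2 i (hi.trans (Nat.le_succ n)),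
            fun i hi => h3 i (hi.trans (Nat.le_succ n))⟩, h1⟩
        · rintro ⟨w, ⟨-, h2, h3⟩, h1⟩
          refine ⟨h1, fun i hi => ?_, fun i hi hi1 => ?_⟩ <;> rcases Nat.le_succ_iff.1 hi with hi | rfl
          · exact h2 i hi
          · simp [h1]
          · exact h3 i hi hi1
          · simp [h1, hy]
      rw [h, measure_iUnion (pairwise_disjoint_tabooEvent_inter X z n _)
        fun w => (hX.measurableSet_tabooEvent z n w).inter (hX.measurableSet_eq _ _)]
      simp only [hX.measure_tabooEvent_inter, ih, taboo_of_ne B hy]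

theorem IsMarkovChain.measure_returnEvent (hX : IsMarkovChain (augmented B) X ℙ) (z : S)
    (n : ℕ) (x : S) : ℙ (some x) (returnEvent X z n) = firstPassage B z n x := by
  rw [returnEvent, measure_iUnion (pairwise_disjoint_tabooEvent_inter X z n _)
    fun w => (hX.measurableSet_tabooEvent z n w).inter (hX.measurableSet_eq _ _)]
  simp only [hX.measure_tabooEvent_inter, hX.measure_tabooEvent, firstPassage]

theorem IsMarkovChain.lintegral_returnTime (hX : IsMarkovChain (augmented B) X ℙ) (z : S)
    (g : ℕ → ℝ≥0∞) (x : S) :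
    ∫⁻ ω, (open Classical in
      if returnTime X z ω < exitTime X ω then g (returnTime X z ω).toNat else 0) ∂(ℙ (some x)) =
      ∑' n, g (n + 1) * firstPassage B z n x := by
  simp only [ite_returnTime_eq_tsum]
  rw [lintegral_tsum fun n =>
    (measurable_const.indicator (hX.measurableSet_returnEvent z n)).aemeasurable]
  refine tsum_congr fun n => ?_
  rw [lintegral_indicator_const (hX.measurableSet_returnEvent z n), hX.measure_returnEvent]

theorem IsMarkovChain.uStar_eq (hX : IsMarkovChain (augmented B) X ℙ) (z : S) (θ : ℝ) (x : S) :
    uStar X ℙ z θ x = passageWeight (fun x y => (Real.exp θ).toNNReal * B x y) z x := by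
  simp only [uStar, expReturn, passageWeight, firstPassage_const_mul, ofReal_exp_mul_natCast]
  exact hX.lintegral_returnTime z (fun n => ((Real.exp θ).toNNReal : ℝ≥0∞) ^ n) x

theorem IsMarkovChain.etaStar_eq (hX : IsMarkovChain (augmented B) X ℙ) (z : S) (θ : ℝ) (y : S) :
    etaStar X ℙ z θ y = occupationWeight (fun x y => (Real.exp θ).toNNReal * B x y) z y := by
  have h : ∀ ω, expOccupation X z θ y ω = ∑' j, (tabooEvent X z j y).indicator
      (fun _ => ((Real.exp θ).toNNReal : ℝ≥0∞) ^ j) ω := by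
    intro ω
    classical
    refine tsum_congr fun j => ?_
    rw [Set.indicator_apply, ofReal_exp_mul_natCast]
    refine if_congr ?_ rfl rfl
    rw [lt_returnTime_iff, lt_exitTime_iff]
    simp only [tabooEvent, Set.mem_ofPred_eq]
    tauto
  simp only [etaStar, h]
  rw [lintegral_tsum fun n =>
    (measurable_const.indicator (hX.measurableSet_tabooEvent z n y)).aemeasurable]
  refine tsum_congr fun n => ?_
  rw [lintegral_indicator_const (hX.measurableSet_tabooEvent z n y), hX.measure_tabooEvent,
    taboo_const_mul, matPow_const_mul]

theorem IsMarkovChain.tsum_occupationWeight_mul_passageWeight_ne_top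
    (hX : IsMarkovChain (augmented B) X ℙ) (z : S) (θ : ℝ) (h : A2 X ℙ z θ) :
    ∑' w, occupationWeight (fun x y => (Real.exp θ).toNNReal * B x y) z w *
      passageWeight (fun x y => (Real.exp θ).toNNReal * B x y) z w ≠ ∞ := by
  rw [tsum_occupationWeight_mul_passageWeight,
    tsum_tsum_add_eq (fun n => firstPassage (fun x y => (Real.exp θ).toNNReal * B x y) z n z)]
  refine ne_of_eq_of_ne ?_ h.ne
  have := hX.lintegral_returnTime z (fun n => n * ((Real.exp θ).toNNReal : ℝ≥0∞) ^ n) z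
  simp only [expReturn, ofReal_exp_mul_natCast, mul_ite, mul_zero, firstPassage_const_mul,
    ← mul_assoc]
  exact this.symm

end Markov

end Probability

/-! ### Rescaling by `e^θ` and the theorem. -/

theorem lamStar_mul_coe_toNNReal_exp (θ : ℝ) :
    lamStar θ * ((Real.exp θ).toNNReal : ℝ≥0∞) = 1 := by
  change ENNReal.ofReal _ * ENNReal.ofReal _ = 1
  rw [← ENNReal.ofReal_mul (Real.exp_pos _).le, ← Real.exp_add]
  simp

theorem isIrreducible_const_mul {S : Type*} {B : S → S → ℝ≥0} (hB : IsIrreducible B) {c : ℝ≥0}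
    (hc : c ≠ 0) : IsIrreducible fun x y => c * B x y := by
  intro x y
  obtain ⟨n, hn⟩ := hB x y
  refine ⟨n, ?_⟩
  rw [matPow_const_mul]
  exact ENNReal.mul_pos (pow_ne_zero n (ENNReal.coe_ne_zero.2 hc)) hn.ne'

theorem period_const_mul {S : Type*} (B : S → S → ℝ≥0) {c : ℝ≥0} (hc : c ≠ 0) (w : S) :
    period (fun x y => c * B x y) w = period B w := by
  have h : ∀ n, (c : ℝ≥0∞) ^ n ≠ 0 := fun n => pow_ne_zero n (ENNReal.coe_ne_zero.2 hc)
  simp only [period, matPow_const_mul, pos_iff_ne_zero, mul_ne_zero_iff, h, ne_eq, not_false_eq_true,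
    true_and]

end PerronFrobenius

open PerronFrobenius in
theorem theorem2 {S : Type*} [Countable S] (B : S → S → ℝ≥0)
    (hsub : IsSubStochastic B) (hirr : IsIrreducible B)
    {Ω : Type*} [MeasurableSpace Ω] (X : ℕ → Ω → Option S) (ℙ : Option S → Measure Ω)
    (hX : IsMarkovChain (augmented B) X ℙ)
    (z : S) (θ : ℝ) (hA1 : A1 X ℙ z θ) (hA2 : A2 X ℙ z θ) :
    (∀ u : S → ℝ≥0, (∀ x, 0 < u x) →
      (∀ x, ∑' y, (B x y : ℝ≥0∞) * (u y : ℝ≥0∞) = lamStar θ * (u x : ℝ≥0∞)) →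
      ∃ c : ℝ≥0, 0 < c ∧ ∀ x, (u x : ℝ≥0∞) = (c : ℝ≥0∞) * uStar X ℙ z θ x) ∧
    (∀ η : S → ℝ≥0, (∀ y, 0 < η y) →
      (∀ y, ∑' x, (η x : ℝ≥0∞) * (B x y : ℝ≥0∞) = lamStar θ * (η y : ℝ≥0∞)) →
      ∃ c : ℝ≥0, 0 < c ∧ ∀ y, (η y : ℝ≥0∞) = (c : ℝ≥0∞) * etaStar X ℙ z θ y) ∧
    (∑' w, etaStar X ℙ z θ w * uStar X ℙ z θ w < ∞) ∧
    (∀ w₀ x y : S,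
      Tendsto
        (fun n : ℕ => (1 / (period B w₀ : ℝ≥0∞)) *
          ∑ j ∈ Finset.range (period B w₀),
            (lamStar θ)⁻¹ ^ (period B w₀ * n + j) * matPow B (period B w₀ * n + j) x y)
        atTop
        (𝓝 (uStar X ℙ z θ x * etaStar X ℙ z θ y /
          ∑' w, uStar X ℙ z θ w * etaStar X ℙ z θ w))) := by
  set r : ℝ≥0 := (Real.exp θ).toNNReal with hr
  have hr0 : r ≠ 0 := (Real.toNNReal_pos.2 (Real.exp_pos θ)).ne'
  have hlr : lamStar θ * r = 1 := lamStar_mul_coe_toNNReal_exp θ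
  set K : S → S → ℝ≥0 := fun x y => r * B x y with hK
  have hirrK : IsIrreducible K := isIrreducible_const_mul hirr hr0
  have hu : ∀ x, uStar X ℙ z θ x = passageWeight K z x := hX.uStar_eq z θ
  have hη : ∀ y, etaStar X ℙ z θ y = occupationWeight K z y := hX.etaStar_eq z θ
  have hone : passageWeight K z z = 1 := (hu z).symm.trans hA1.2
  have hfin : ∑' w, occupationWeight K z w * passageWeight K z w ≠ ∞ :=
    hX.tsum_occupationWeight_mul_passageWeight_ne_top z θ hA2
  simp only [hu, hη]
  -- The constants are the values at `z`, since `u_*(z) = η_*(z) = 1`.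
  refine ⟨fun u hpos hfix => ⟨u z, hpos z, eq_mul_passageWeight hirrK hone fun x => ?_⟩,
    fun η hpos hfix => ⟨η z, hpos z, eq_mul_occupationWeight hirrK hone fun y => ?_⟩,
    hfin.lt_top, fun w₀ x y => ?_⟩
  · simp only [hK, ENNReal.coe_mul, mul_assoc, ENNReal.tsum_mul_left, hfix x]
    rw [← mul_assoc, mul_comm (r : ℝ≥0∞), hlr, one_mul]
  · simp only [hK, ENNReal.coe_mul, mul_left_comm _ (r : ℝ≥0∞), ENNReal.tsum_mul_left, hfix y]
    rw [← mul_assoc, mul_comm (r : ℝ≥0∞), hlr, one_mul]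
  · have hp : period B w₀ = period K z := by
      rw [period_eq_period hirr w₀ z, hK, period_const_mul B hr0]
    have hinv : (lamStar θ)⁻¹ = r := by
      refine (ENNReal.eq_inv_of_mul_eq_one_left ?_).symm
      rw [mul_comm, hlr]
    have hmat : ∀ n, (lamStar θ)⁻¹ ^ n * matPow B n x y = matPow K n x y := fun n => by
      rw [hinv, hK, matPow_const_mul]
    simp only [hp, hmat, mul_comm (passageWeight K z _) (occupationWeight K z _)]
    set D := ∑' w, occupationWeight K z w * passageWeight K z w with hD
    set p := period K z with hpdef
    have hp0 : p ≠ 0 := (period_pos hone).ne'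
    have hD0 : D ≠ 0 := by
      have : occupationWeight K z z * passageWeight K z z ≤ D :=
        ENNReal.le_tsum (f := fun w => occupationWeight K z w * passageWeight K z w) z
      rw [occupationWeight_self, hone, one_mul] at this
      exact (one_pos.trans_le this).ne'
    have hsum : ∀ n, ∀ j ∈ Finset.range p, matPow K (p * n + j) x y ≠ ∞ := fun n j _ =>
      matPow_ne_top hirrK hone _ x y
    -- All terms and the limit are finite, so the convergence can be checked in the reals.
    refine (ENNReal.tendsto_toReal_iff (fun n => ?_) ?_).1 ?_
    · exact ENNReal.mul_ne_top (by simp [hp0]) (ENNReal.sum_ne_top.2 (hsum n))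
    · exact ENNReal.div_ne_top (ENNReal.mul_ne_top (occupationWeight_ne_top hirrK hone y)
        (passageWeight_ne_top hirrK hone x)) hD0
    · have hlim := (tendsto_sum_matPow hirrK hone hfin x y).const_mul (1 / (p : ℝ))
      rw [← hpdef, ← hD] at hlim
      convert hlim using 2
      · rw [ENNReal.toReal_mul, ENNReal.toReal_sum (hsum _)]
        simp
      · rw [ENNReal.toReal_div, ENNReal.toReal_mul]
        have : (p : ℝ) ≠ 0 := Nat.cast_ne_zero.2 hp0
        field_simp
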